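/- **Instability of the equilibrium points under the Poynting–Robertson effect.** Let $0<\mu<\tfrac12$, $0\le q_1\le 1$, $A_2\ge 0$, $M_b\ge 0$, $T\ge 0$, $c_d>0$, and put $$W_1=\frac{(1-\mu)(1-q_1)}{c_d},\qquad r_c^2=(1-\mu)q_1^{2/3}+\mu^2,\qquad n^2=1+\frac{3A_2}{2}+\frac{2M_br_c}{(r_c^2+T^2)^{3/2}}\quad(n>0),$$ $$r^2=x^2+y^2,\qquad r_1^2=(x+\mu)^2+y^2,\qquad r_2^2=(x+\mu-1)^2+y^2.$$ Consider the planar generalized photogravitational Chermnykh problem $\ddot x-2n\dot y=\Omega_x$, $\ddot y+2n\dot x=\Omega_y$, where $$\Omega_x=n^2x-\frac{(1-\mu)q_1(x+\mu)}{r_1^3}-\frac{\mu(x+\mu-1)}{r_2^3}-\frac32\frac{\mu A_2(x+\mu-1)}{r_2^5}-\frac{M_bx}{(r^2+T^2)^{3/2}}-\frac{W_1}{r_1^2}\Big\{\frac{x+\mu}{r_1^2}\big[(x+\mu)\dot x+y\dot y\big]+\dot x-ny\Big\},$$ $$\Omega_y=n^2y-\frac{(1-\mu)q_1y}{r_1^3}-\frac{\mu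 y}{r_2^3}-\frac32\frac{\mu A_2y}{r_2^5}-\frac{M_by}{(r^2+T^2)^{3/2}}-\frac{W_1}{r_1^2}\Big\{\frac{y}{r_1^2}\big[(x+\mu)\dot x+y\dot y\big]+\dot y+n(x+\mu)\Big\}$$ on the set of positions with $r_1\neq0$, $r_2\ne0$ and, if $M_b\neq0$, $r^2+T^2\neq0$. An equilibrium point is such a position $(x,y)$ at which $\Omega_x=\Omega_y=0$ when $\dot x=\dot y=0$. Suppose $W_1\ne0$, and let $(x,y)$ be any equilibrium point (near-collinear or triangular); if $M_b\neq 0$, suppose also that it lies outside the core of the belt, $x^2+y^2\ge 2T^2$. Then the following hold. 1. The equations of motion, written as a first-order system in $(x,y,\dot x,\dot y)$, are differentiable at the rest point $(x,y,0,0)$, and, with all partial derivatives taken there, the characteristic polynomial of the linearised system is $$\begin{vmatrix}\lambda^2-\lambda\Omega_{x\dot x}-\Omega_{xx}&-(2n+\Omega_{x\dot y})\lambda-\Omega_{xy}\\(2n-\Omega_{y\dot x})\lambda-\Omega_{yx}&\lambda^2-\lambda\Omega_{y\dot y}-\Omega_{yy}\end{vmatrix}=\lambda^4+a\lambda^3+b\lambda^2+c\lambda+d,$$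 where, with $f=\frac{(1-\mu)q_1}{r_1^3}+\frac{\mu}{r_2^3}\big(1+\frac{3A_2}{2r_2^2}\big)+\frac{M_b}{(r^2+T^2)^{3/2}}$ and $\kappa=1+\frac{5A_2}{2r_2^2}$, $$a=\frac{3W_1}{r_1^2}>0,\qquad b=2n^2-f-\frac{3\mu A_2}{r_2^5}+\frac{3M_bT^2}{(r^2+T^2)^{5/2}}+\frac{2W_1^2}{r_1^4},$$ $$c=-a(n^2+e),\qquad e=\frac{\mu A_2}{r_2^5}+\frac{\mu\kappa y^2}{r_1^2r_2^5}+\frac{M_b\big(\mu^2y^2/r_1^2-T^2\big)}{(r^2+T^2)^{5/2}},$$ $$d=(n^2-f)\Big[n^2+2f+\frac{3\mu A_2}{r_2^5}-\frac{3M_bT^2}{(r^2+T^2)^{5/2}}\Big]+9\mu(1-\mu)y^2\Big[\frac{q_1\kappa}{r_1^5r_2^5}+\frac{M_b}{(r^2+T^2)^{5/2}}\Big\{\frac{\mu q_1}{r_1^5}+\frac{(1-\mu)\kappa}{r_2^5}\Big\}\Big]$$ $$\qquad-\frac{6\mu nW_1y}{r_1^4}\Big\{\frac{[(x+\mu)(x+\mu-1)+y^2]\,\kappa}{r_2^5}+\frac{M_b[x(x+\mu)+y^2]}{(r^2+T^2)^{5/2}}\Big\}-\frac{n^2W_1^2}{r_1^4}.$$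 (Terms with the factor $M_b$ are read as $0$ if $M_b=0$.) 2. At least one complex root $\lambda$ of this quartic has positive real part. 3. The equilibrium is unstable in the sense of Lyapunov for the nonlinear equations of motion: it is false that for every $\varepsilon>0$ there is a $\delta>0$ such that every solution, on any time interval $[0,\tau]$, that starts in phase space within $\delta$ of $(x,y,0,0)$ stays within $\varepsilon$ of it. -/

import Mathlib

open Polynomial

noncomputable section

/-- Parameters of the planar generalized photogravitational Chermnykh problem
(units: total mass, distance of the primaries and gravitational constant equal to one). -/
structure Chermnykh where
  /-- mass parameter `m₂ / (m₁ + m₂)` -/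
  mu : ℝ
  /-- mass reduction factor `1 - F_p / F_g` of the radiating primary -/
  q1 : ℝ
  /-- oblateness coefficient of the smaller primary -/
  A2 : ℝ
  /-- mass of the belt -/
  Mb : ℝ
  /-- flatness plus core parameter of the belt -/
  T : ℝ
  /-- dimensionless velocity of light -/
  cd : ℝ

namespace Chermnykh

/-- The physical range of the parameters. -/
structure Admissible (P : Chermnykh) : Prop where
  mu_pos : 0 < P.mu
  mu_lt : P.mu < 1 / 2
  q1_nonneg : 0 ≤ P.q1
  q1_le : P.q1 ≤ 1
  A2_nonneg : 0 ≤ P.A2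
  Mb_nonneg : 0 ≤ P.Mb
  T_nonneg : 0 ≤ P.T
  cd_pos : 0 < P.cd

variable (P : Chermnykh)

/-- Reference radius of the belt: `r_c² = (1 - μ) q₁^(2/3) + μ²`. -/
def rc : ℝ := √((1 - P.mu) * P.q1 ^ (2 / 3 : ℝ) + P.mu ^ 2)

/-- Perturbed mean motion: `n² = 1 + 3 A₂ / 2 + 2 M_b r_c / (r_c² + T²)^(3/2)`. -/
def n : ℝ := √(1 + 3 * P.A2 / 2 + 2 * P.Mb * P.rc / √(P.rc ^ 2 + P.T ^ 2) ^ 3)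

/-- Poynting-Robertson parameter. -/
def W1 : ℝ := (1 - P.mu) * (1 - P.q1) / P.cd

/-- Distance to the bigger primary, located at `(-μ, 0)`. -/
def r1 (x y : ℝ) : ℝ := √((x + P.mu) ^ 2 + y ^ 2)

/-- Distance to the smaller primary, located at `(1 - μ, 0)`. -/
def r2 (x y : ℝ) : ℝ := √((x + P.mu - 1) ^ 2 + y ^ 2)

/-- Softened distance to the barycentre: `(r² + T²)^(1/2)` with `r² = x² + y²`. -/
def rT (x y : ℝ) : ℝ := √(x ^ 2 + y ^ 2 + P.T ^ 2)

/-- The right-hand side `Ω_x` of the first equation of motion, as a function of the phase point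
`z = (x, y, x', y')`. -/
def OmegaX (z : Fin 4 → ℝ) : ℝ :=
  let x := z 0; let y := z 1; let vx := z 2; let vy := z 3
  P.n ^ 2 * x - (1 - P.mu) * P.q1 * (x + P.mu) / P.r1 x y ^ 3
    - P.mu * (x + P.mu - 1) / P.r2 x y ^ 3
    - 3 / 2 * (P.mu * P.A2 * (x + P.mu - 1)) / P.r2 x y ^ 5
    - P.Mb * x / P.rT x y ^ 3
    - P.W1 / P.r1 x y ^ 2 *
      ((x + P.mu) / P.r1 x y ^ 2 * ((x + P.mu) * vx + y * vy) + vx - P.n * y)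

/-- The right-hand side `Ω_y` of the second equation of motion. -/
def OmegaY (z : Fin 4 → ℝ) : ℝ :=
  let x := z 0; let y := z 1; let vx := z 2; let vy := z 3
  P.n ^ 2 * y - (1 - P.mu) * P.q1 * y / P.r1 x y ^ 3
    - P.mu * y / P.r2 x y ^ 3
    - 3 / 2 * (P.mu * P.A2 * y) / P.r2 x y ^ 5
    - P.Mb * y / P.rT x y ^ 3
    - P.W1 / P.r1 x y ^ 2 *
      (y / P.r1 x y ^ 2 * ((x + P.mu) * vx + y * vy) + vy + P.n * (x + P.mu))

/-- The phase-space vector field of `x'' - 2 n y' = Ω_x`, `y'' + 2 n x' = Ω_y`. -/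
def field (z : Fin 4 → ℝ) : Fin 4 → ℝ :=
  ![z 2, z 3, 2 * P.n * z 3 + P.OmegaX z, -(2 * P.n * z 2) + P.OmegaY z]

/-- The phase space: positions away from both primaries and, when the belt degenerates to a point
mass (`T = 0 < M_b`), away from the barycentre. -/
def phaseSpace : Set (Fin 4 → ℝ) :=
  {z | P.r1 (z 0) (z 1) ≠ 0 ∧ P.r2 (z 0) (z 1) ≠ 0 ∧ (P.Mb ≠ 0 → P.rT (z 0) (z 1) ≠ 0)}

/-- `(x, y)` is an equilibrium point: the particle at rest there satisfies `Ω_x = Ω_y = 0`. -/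
def IsEquilibrium (x y : ℝ) : Prop :=
  ![x, y, 0, 0] ∈ P.phaseSpace ∧ P.OmegaX ![x, y, 0, 0] = 0 ∧ P.OmegaY ![x, y, 0, 0] = 0

end Chermnykh

/-- Partial derivative of `f` with respect to the `i`-th phase coordinate at `z`. -/
def partialAt (f : (Fin 4 → ℝ) → ℝ) (i : Fin 4) (z : Fin 4 → ℝ) : ℝ :=
  deriv (fun s => f (Function.update z i s)) (z i)

/-- `z` solves `z' = F z` on `[0, τ]` and stays in `U`. -/
def IsSolutionOn {E : Type*} [NormedAddCommGroup E] [NormedSpace ℝ E]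
    (F : E → E) (U : Set E) (τ : ℝ) (z : ℝ → E) : Prop :=
  ∀ t ∈ Set.Icc 0 τ, z t ∈ U ∧ HasDerivWithinAt z (F (z t)) (Set.Icc 0 τ) t

/-- Lyapunov stability of the equilibrium `p` of `z' = F z` in `U`: solutions starting close to `p`
stay close to `p` for as long as they exist. -/
def LyapunovStable {E : Type*} [NormedAddCommGroup E] [NormedSpace ℝ E]
    (F : E → E) (U : Set E) (p : E) : Prop :=
  ∀ ε > 0, ∃ δ > 0, ∀ τ ≥ 0, ∀ z : ℝ → E, IsSolutionOn F U τ z → ‖z 0 - p‖ < δ →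
    ∀ t ∈ Set.Icc 0 τ, ‖z t - p‖ < ε

namespace Chermnykh

variable (P : Chermnykh)

/-- The characteristic determinant of the system linearised at the rest point `(x, y)`: the
condition for displacements `(ξ, η) exp (λ t)`, as a polynomial in `λ`. -/
def charDet (x y : ℝ) : ℝ[X] :=
  let D (f : (Fin 4 → ℝ) → ℝ) (i : Fin 4) : ℝ[X] := C (partialAt f i ![x, y, 0, 0])
  Matrix.det
    !![X ^ 2 - X * D P.OmegaX 2 - D P.OmegaX 0, -(2 * C P.n + D P.OmegaX 3) * X - D P.OmegaX 1;
       (2 * C P.n - D P.OmegaY 2) * X - D P.OmegaY 0, X ^ 2 - X * D P.OmegaY 3 - D P.OmegaY 1]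

/-- `f = (1-μ) q₁ / r₁³ + (μ / r₂³) (1 + 3 A₂ / (2 r₂²)) + M_b / (r² + T²)^(3/2)`. -/
def coeffF (x y : ℝ) : ℝ :=
  (1 - P.mu) * P.q1 / P.r1 x y ^ 3
    + P.mu / P.r2 x y ^ 3 * (1 + 3 / 2 * P.A2 / P.r2 x y ^ 2) + P.Mb / P.rT x y ^ 3

/-- The recurring factor `1 + 5 A₂ / (2 r₂²)`. -/
def obl (x y : ℝ) : ℝ := 1 + 5 * P.A2 / (2 * P.r2 x y ^ 2)

/-- The quantity `e` in the coefficient of `λ`. -/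
def coeffE (x y : ℝ) : ℝ :=
  P.mu * P.A2 / P.r2 x y ^ 5
    + P.mu / (P.r1 x y ^ 2 * P.r2 x y ^ 5) * P.obl x y * y ^ 2
    + P.Mb * (P.mu ^ 2 * y ^ 2 / P.r1 x y ^ 2 - P.T ^ 2) / P.rT x y ^ 5

/-- Coefficient of `λ³`. -/
def coeffa (x y : ℝ) : ℝ := 3 * P.W1 / P.r1 x y ^ 2

/-- Coefficient of `λ²`. -/
def coeffb (x y : ℝ) : ℝ :=
  2 * P.n ^ 2 - P.coeffF x y - 3 * P.mu * P.A2 / P.r2 x y ^ 5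
    + 3 * P.Mb * P.T ^ 2 / P.rT x y ^ 5 + 2 * P.W1 ^ 2 / P.r1 x y ^ 4

/-- Coefficient of `λ`. -/
def coeffc (x y : ℝ) : ℝ := -P.coeffa x y * (P.n ^ 2 + P.coeffE x y)

/-- Constant coefficient. -/
def coeffd (x y : ℝ) : ℝ :=
  (P.n ^ 2 - P.coeffF x y) * (P.n ^ 2 + 2 * P.coeffF x y + 3 * P.mu * P.A2 / P.r2 x y ^ 5
      - 3 * P.Mb * P.T ^ 2 / P.rT x y ^ 5)
    + 9 * P.mu * (1 - P.mu) * y ^ 2 *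
      (P.q1 * P.obl x y / (P.r1 x y ^ 5 * P.r2 x y ^ 5)
        + P.Mb / P.rT x y ^ 5 *
          (P.mu * P.q1 / P.r1 x y ^ 5 + (1 - P.mu) * P.obl x y / P.r2 x y ^ 5))
    - 6 * P.mu * P.n * P.W1 * y / P.r1 x y ^ 4 *
      (((x + P.mu) * (x + P.mu - 1) + y ^ 2) * P.obl x y / P.r2 x y ^ 5
        + P.Mb * (x * (x + P.mu) + y ^ 2) / P.rT x y ^ 5)
    - P.n ^ 2 * P.W1 ^ 2 / P.r1 x y ^ 4

end Chermnykh

end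

/-! At a rest point the Jacobian `M` of the forces with respect to position is symmetric: the drag
at rest is `-W₁ n` times the gradient of the polar angle about the radiating primary, so it is
curl-free off that primary. The damping matrix is `-(W₁/r₁²)(I + û ûᵀ)`, with `û` the unit radial
vector from that primary. Hence the linear coefficient is `c = -(W₁/r₁²)(tr M + Q)`, where `Q` is
the value of the form `M` on the unit tangential vector. Tangentially the drag part of `M` and the
attraction of the radiating primary drop out, which leaves `tr M + Q = 3(n² + e)` (`jac_form`).

If `n² + e > 0`, then `c < 0`: the derivative of the quartic has a positive root, and by Gauss–Lucas
the quartic has a root in the right half-plane. If `n² + e ≤ 0`, then `Q ≤ -tr M < 0`, because `tr M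
> 0` outside the core (`jac_trace_pos`). A symmetric `2 × 2` matrix with positive trace and a
negative direction has negative determinant, so `d < 0` and there is a positive real root.

Nonlinear instability is Lyapunov's first method (`not_lyapunovStable_of_eigenvalue`). A form `B`
solving `B(Au, v) + B(u, Av) = 2σ B(u, v) + B₀(u, v)` with `B₀` positive definite and `0 < σ < Re λ`
is positive somewhere on the eigenplane and grows at least like `exp (2σt)` along solutions near the
point. Stability would confine such solutions, make them exist for all times, and so contradict the
growth. -/

section Instability

open Set Metric Filter Topology
open scoped NNReal

/-! ### Long-time existence of solutions confined to a ball. -/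

/-- A closed ball of a finite power of `ℝ` is a Lipschitz retract of the whole space. -/
theorem exists_lipschitz_retraction_closedBall {ι : Type*} [Fintype ι] (p : ι → ℝ) {r : ℝ}
    (hr : 0 ≤ r) :
    ∃ g : (ι → ℝ) → ι → ℝ, LipschitzWith 1 g ∧ (∀ z, g z ∈ closedBall p r) ∧
      ∀ z ∈ closedBall p r, g z = z := by
  -- In the sup norm the ball is a box, so clamping each coordinate is a retraction.
  refine ⟨fun z i => max (p i - r) (min (p i + r) (z i)), ?_, fun z => ?_, fun z hz => ?_⟩
  · refine LipschitzWith.of_dist_le_mul fun z w => ?_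
    rw [NNReal.coe_one, one_mul]
    refine (dist_pi_le_iff dist_nonneg).2 fun i => ?_
    refine le_trans ?_ (dist_le_pi_dist z w i)
    have h1 := abs_max_sub_max_le_max (p i - r) (min (p i + r) (z i)) (p i - r)
      (min (p i + r) (w i))
    have h2 := abs_min_sub_min_le_max (p i + r) (z i) (p i + r) (w i)
    simp only [sub_self, abs_zero, max_eq_right, abs_nonneg] at h1 h2
    exact h1.trans h2
  · refine (mem_closedBall.2 ((dist_pi_le_iff hr).2 fun i => ?_))
    rw [Real.dist_eq, abs_le]
    constructor
    · linarith [le_max_left (p i - r) (min (p i + r) (z i))]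
    · linarith [max_le (show p i - r ≤ p i + r by linarith) (min_le_left (p i + r) (z i))]
  · funext i
    have h := (dist_pi_le_iff hr).1 (mem_closedBall.1 hz) i
    rw [Real.dist_eq, abs_le] at h
    simp only
    rw [min_eq_right (by linarith), max_eq_right (by linarith)]

/-- A bounded Lipschitz vector field has solutions on every interval `[0, τ]`. -/
theorem exists_solution_of_lipschitzWith_of_bounded {E : Type*} [NormedAddCommGroup E]
    [NormedSpace ℝ E] [CompleteSpace E] {G : E → E} {K L : ℝ≥0} (hG : LipschitzWith K G)
    (hL : ∀ z, ‖G z‖ ≤ L) (z₀ : E) {τ : ℝ} (hτ : 0 ≤ τ) :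
    ∃ z : ℝ → E, z 0 = z₀ ∧ ∀ t ∈ Icc 0 τ, HasDerivWithinAt z (G (z t)) (Icc 0 τ) t := by
  -- Speed at most `L` keeps the solution within `L τ` of its start. A ball of that radius, with
  -- initial points restricted to radius `0`, makes Picard–Lindelöf cover the whole interval.
  have h : IsPicardLindelof (fun _ => G) (⟨0, le_rfl, hτ⟩ : Icc (0 : ℝ) τ) z₀
      (L * ⟨τ, hτ⟩) 0 L K := by
    refine IsPicardLindelof.of_time_independent (fun x _ => hL x) hG.lipschitzOnWith ?_
    simp only [sub_zero, sub_self, NNReal.coe_zero, max_eq_left hτ]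
    exact le_rfl
  exact h.exists_eq_forall_mem_Icc_hasDerivWithinAt₀

/-- If a vector field is Lipschitz on a closed ball contained in the phase space and every solution
from a given initial point stays in the open ball, then there are arbitrarily long solutions from
that point. -/
theorem exists_solution_of_forall_mem_ball {ι : Type*} [Fintype ι] {F : (ι → ℝ) → ι → ℝ}
    {U : Set (ι → ℝ)} {p : ι → ℝ} {r : ℝ} {K : ℝ≥0} (hF : LipschitzOnWith K F (closedBall p r))
    (hU : closedBall p r ⊆ U) {z₀ : ι → ℝ} (hz₀ : z₀ ∈ ball p r)
    (hstay : ∀ τ ≥ 0, ∀ z : ℝ → ι → ℝ, IsSolutionOn F U τ z → z 0 = z₀ →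
      ∀ t ∈ Icc 0 τ, z t ∈ ball p r) {τ : ℝ} (hτ : 0 ≤ τ) :
    ∃ z : ℝ → ι → ℝ, z 0 = z₀ ∧ IsSolutionOn F U τ z := by
  have hr : 0 ≤ r := dist_nonneg.trans (mem_ball.1 hz₀).le
  obtain ⟨g, hg, hgm, hgid⟩ := exists_lipschitz_retraction_closedBall p hr
  have hG : LipschitzWith (K * 1) (F ∘ g) :=
    lipschitzOnWith_univ.1 (hF.comp hg.lipschitzOnWith fun z _ => hgm z)
  have hL : ∀ z, ‖(F ∘ g) z‖ ≤ (‖F p‖₊ + K * ⟨r, hr⟩ : ℝ≥0) := fun z => by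
    have h1 := hF.dist_le_mul (g z) (hgm z) p (mem_closedBall_self hr)
    have h2 : dist (g z) p ≤ r := hgm z
    have h3 : ‖F (g z)‖ ≤ ‖F p‖ + dist (F (g z)) (F p) := by
      rw [dist_eq_norm]
      simpa using norm_add_le (F p) (F (g z) - F p)
    have h4 : (K : ℝ) * dist (g z) p ≤ K * r := by gcongr
    change ‖F (g z)‖ ≤ ‖F p‖ + K * r
    linarith
  obtain ⟨z, hz0, hz⟩ := exists_solution_of_lipschitzWith_of_bounded hG hL z₀ hτ
  have hzc : ContinuousOn z (Icc 0 τ) := fun t ht => (hz t ht).continuousWithinAt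
  have hsol : ∀ s ∈ Icc 0 τ, (∀ t ∈ Icc 0 s, z t ∈ closedBall p r) → IsSolutionOn F U s z := by
    intro s hs h t ht
    have ht' : t ∈ Icc 0 τ := ⟨ht.1, ht.2.trans hs.2⟩
    refine ⟨hU (h t ht), ?_⟩
    have := (hz t ht').mono (Icc_subset_Icc_right hs.2)
    rwa [Function.comp_apply, hgid _ (h t ht)] at this
  have hin : ∀ t ∈ Icc 0 τ, z t ∈ ball p r := by
    by_contra! hcon
    obtain ⟨t₁, ht₁, hz₁⟩ := hcon
    -- First exit from the open ball: up to `sInf S` the solution of the truncated field stays in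
    -- the closed ball, so it also solves the original equation, and `hstay` then keeps the endpoint
    -- inside.
    set S : Set ℝ := Icc 0 τ ∩ z ⁻¹' (ball p r)ᶜ with hS
    have hSc : IsClosed S := hzc.preimage_isClosed_of_isClosed isClosed_Icc isOpen_ball.isClosed_compl
    have hSne : S.Nonempty := ⟨t₁, ht₁, hz₁⟩
    have hSb : BddBelow S := ⟨0, fun t ht => ht.1.1⟩
    have hs : sInf S ∈ S := hSc.csInf_mem hSne hSb
    set s := sInf S
    have hlt : ∀ t ∈ Ico 0 s, z t ∈ ball p r := fun t ht => by
      by_contra h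
      exact (csInf_le hSb ⟨⟨ht.1, ht.2.le.trans hs.1.2⟩, h⟩).not_gt ht.2
    have hs0 : 0 < s := by
      refine lt_of_le_of_ne hs.1.1 fun h => hs.2 ?_
      rwa [← h, hz0]
    have hle : ∀ t ∈ Icc 0 s, z t ∈ closedBall p r := by
      have hcl : closure (Ico 0 s) = Icc 0 s := closure_Ico hs0.ne
      intro t ht
      have hmap : MapsTo z (closure (Ico 0 s)) (closure (closedBall p r)) :=
        MapsTo.closure_of_continuousOn (fun t ht => ball_subset_closedBall (hlt t ht))
          (hzc.mono (by rw [hcl]; exact Icc_subset_Icc_right hs.1.2))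
      have := hmap (by rwa [hcl] : t ∈ closure (Ico 0 s))
      rwa [isClosed_closedBall.closure_eq] at this
    exact hs.2 (hstay s hs.1.1 z (hsol s hs.1 hle) hz0 s ⟨hs.1.1, le_rfl⟩)
  exact ⟨z, hz0, hsol τ ⟨hτ, le_rfl⟩ fun t ht => ball_subset_closedBall (hin t ht)⟩

/-! ### The shifted Lyapunov equation and instability from the linearisation. -/

/-- A linear endomorphism of a finite-dimensional real space becomes surjective after subtraction of
a suitable, arbitrarily small, positive multiple of the identity. -/
theorem IsLinearMap.exists_pos_lt_eq_smul_add {V : Type*} [AddCommGroup V] [Module ℝ V]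
    [FiniteDimensional ℝ V] {f : V → V} (hf : IsLinearMap ℝ f) (b : V) {w : ℝ} (hw : 0 < w) :
    ∃ s, 0 < s ∧ s < w ∧ ∃ x, f x = s • x + b := by
  set Λ : Module.End ℝ V := hf.mk' f
  have hfin : {μ : ℝ | Λ.HasEigenvalue μ}.Finite := Module.End.finite_hasEigenvalue Λ
  obtain ⟨s, hs, hsΛ⟩ := (Ioo_infinite hw).exists_notMem_finite hfin
  have hinj : Function.Injective (Λ - algebraMap ℝ (Module.End ℝ V) s) := by
    rw [← LinearMap.ker_eq_bot]
    by_contra h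
    refine hsΛ (Module.End.hasEigenvalue_iff.2 ?_)
    rwa [Module.End.eigenspace_def]
  obtain ⟨x, hx⟩ := (LinearMap.injective_iff_surjective.1 hinj) b
  refine ⟨s, hs.1, hs.2, x, ?_⟩
  rw [← hx]
  simp [Λ, Algebra.algebraMap_eq_smul_one]

/-- Solvability of a shifted Lyapunov equation with an arbitrarily small positive shift. -/
theorem exists_lyapunov_form {E : Type*} [NormedAddCommGroup E] [NormedSpace ℝ E]
    [FiniteDimensional ℝ E] (A : E →L[ℝ] E) (B₀ : E →L[ℝ] E →L[ℝ] ℝ) {α : ℝ} (hα : 0 < α) :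
    ∃ σ, 0 < σ ∧ σ < α ∧ ∃ B : E →L[ℝ] E →L[ℝ] ℝ,
      ∀ u v, B (A u) v + B u (A v) = 2 * σ * B u v + B₀ u v := by
  have hlin : IsLinearMap ℝ fun B : E →L[ℝ] E →L[ℝ] ℝ =>
      B.bilinearComp A (.id ℝ E) + B.bilinearComp (.id ℝ E) A :=
    { map_add := fun B C => ContinuousLinearMap.ext fun u => ContinuousLinearMap.ext fun v =>
        add_add_add_comm ..
      map_smul := fun c B => ContinuousLinearMap.ext fun u => ContinuousLinearMap.ext fun v =>
        (mul_add c _ _).symm }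
  obtain ⟨s, hs0, hsα, B, hB⟩ := hlin.exists_pos_lt_eq_smul_add B₀ (show 0 < 2 * α by linarith)
  refine ⟨s / 2, by linarith, by linarith, B, fun u v => ?_⟩
  have h : B (A u) v + B u (A v) = s * B u v + B₀ u v :=
    congrArg (fun C : E →L[ℝ] E →L[ℝ] ℝ => C u v) hB
  linarith

/-- The Lyapunov form is positive somewhere on an invariant plane (or line) on which the linear map
has an eigenvalue with large real part. -/
theorem exists_lyapunov_form_pos {E : Type*} [NormedAddCommGroup E] [NormedSpace ℝ E]
    {A : E →L[ℝ] E} {B B₀ : E →L[ℝ] E →L[ℝ] ℝ} {α β σ : ℝ} (hσ : σ < α)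
    (hB : ∀ u v, B (A u) v + B u (A v) = 2 * σ * B u v + B₀ u v)
    (hB₀ : ∀ u, u ≠ 0 → 0 < B₀ u u) {u v : E} (hu : A u = α • u - β • v)
    (hv : A v = α • v + β • u) (huv : u ≠ 0 ∨ v ≠ 0) : ∃ w, 0 < B w w := by
  have hnn : ∀ u, 0 ≤ B₀ u u := fun u => by
    rcases eq_or_ne u 0 with rfl | h
    · simp
    · exact (hB₀ u h).le
  have h1 := hB u u
  have h2 := hB v v
  rw [hu] at h1
  rw [hv] at h2
  simp only [map_sub, map_add, map_smul, add_apply,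
    sub_apply, smul_apply, smul_eq_mul] at h1 h2
  have h3 : 0 < B₀ u u + B₀ v v := by
    rcases huv with h | h
    · linarith [hB₀ u h, hnn v]
    · linarith [hB₀ v h, hnn u]
  by_contra! hcon
  -- Adding `h1` and `h2` cancels the `β` terms without symmetry of `B`: `2(α - σ)(B u u + B v v) =
  -- B₀ u u + B₀ v v > 0`.
  nlinarith [hcon u, hcon v, mul_nonneg (sub_nonneg.2 hσ.le) (neg_nonneg.2 (hcon u)),
    mul_nonneg (sub_nonneg.2 hσ.le) (neg_nonneg.2 (hcon v))]

/-- **Lyapunov's first method.** A rest point at which the vector field is continuously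
differentiable is unstable if the linearisation has an eigenvalue `α + β i` with `α > 0`. -/
theorem not_lyapunovStable_of_eigenvalue {ι : Type*} [Fintype ι] {F : (ι → ℝ) → ι → ℝ}
    {U : Set (ι → ℝ)} {p : ι → ℝ} (hU : U ∈ 𝓝 p) (hF : ContDiffAt ℝ 1 F p) (hFp : F p = 0)
    {A : (ι → ℝ) →L[ℝ] (ι → ℝ)} (hA : HasFDerivAt F A p) {α β : ℝ} (hα : 0 < α)
    {u v : ι → ℝ} (hu : A u = α • u - β • v) (hv : A v = α • v + β • u)
    (huv : u ≠ 0 ∨ v ≠ 0) : ¬ LyapunovStable F U p := by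
  intro hst
  set B₀ : (ι → ℝ) →L[ℝ] (ι → ℝ) →L[ℝ] ℝ :=
    ∑ i, (ContinuousLinearMap.proj i : (ι → ℝ) →L[ℝ] ℝ).smulRight
      (ContinuousLinearMap.proj i : (ι → ℝ) →L[ℝ] ℝ) with hB₀def
  have hB₀ : ∀ h, ‖h‖ ^ 2 ≤ B₀ h h := fun h => by
    have hval : B₀ h h = ∑ i, h i ^ 2 := by
      simp [hB₀def, sq]
    have hnn : 0 ≤ ∑ i, h i ^ 2 := Finset.sum_nonneg fun i _ => sq_nonneg _
    rw [hval, ← Real.le_sqrt (norm_nonneg _) hnn]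
    refine (pi_norm_le_iff_of_nonneg (Real.sqrt_nonneg _)).2 fun i => ?_
    rw [Real.norm_eq_abs]
    exact Real.abs_le_sqrt (Finset.single_le_sum (f := fun i => h i ^ 2)
      (fun i _ => sq_nonneg _) (Finset.mem_univ i))
  obtain ⟨σ, hσ, hσα, B, hB⟩ := exists_lyapunov_form A B₀ hα
  obtain ⟨w, hw⟩ := exists_lyapunov_form_pos hσα hB
    (fun h hh => lt_of_lt_of_le (by positivity) (hB₀ h)) hu hv huv
  -- growth of the form along the vector field near the rest point
  have hgrow : ∀ᶠ z in 𝓝 p, 2 * σ * B (z - p) (z - p) ≤ B (F z) (z - p) + B (z - p) (F z) := by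
    -- With this bound on the nonlinear remainder, its two contributions total at most `‖h‖ ^ 2`,
    -- which `B₀ h h` absorbs; the `+ 1` covers `B = 0`.
    have hpos : (0 : ℝ) < 1 / (2 * ‖B‖ + 1) := by positivity
    filter_upwards [hA.isLittleO.def hpos] with z hz
    rw [hFp, sub_zero] at hz
    set h := z - p
    have e1 : ‖B (F z - A h) h‖ ≤ ‖B‖ * ‖F z - A h‖ * ‖h‖ := B.le_opNorm₂ _ _
    have e2 : ‖B h (F z - A h)‖ ≤ ‖B‖ * ‖h‖ * ‖F z - A h‖ := B.le_opNorm₂ _ _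
    have e3 : 2 * ‖B‖ * ‖F z - A h‖ * ‖h‖ ≤ ‖h‖ ^ 2 := by
      have : 2 * ‖B‖ * (1 / (2 * ‖B‖ + 1)) ≤ 1 := by
        rw [mul_one_div, div_le_one (by positivity)]
        linarith
      calc 2 * ‖B‖ * ‖F z - A h‖ * ‖h‖ ≤ 2 * ‖B‖ * (1 / (2 * ‖B‖ + 1) * ‖h‖) * ‖h‖ := by gcongr
        _ = 2 * ‖B‖ * (1 / (2 * ‖B‖ + 1)) * ‖h‖ ^ 2 := by ring
        _ ≤ 1 * ‖h‖ ^ 2 := by gcongr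
        _ = ‖h‖ ^ 2 := one_mul _
    have e4 : B (F z) h = B (F z - A h) h + B (A h) h := by simp
    have e5 : B h (F z) = B h (F z - A h) + B h (A h) := by simp
    rw [Real.norm_eq_abs] at e1 e2
    have := hB h h
    linarith [neg_abs_le (B (F z - A h) h), neg_abs_le (B h (F z - A h)), hB₀ h]
  obtain ⟨K, s, hs, hK⟩ := hF.exists_lipschitzOnWith
  obtain ⟨r, hr, hball⟩ := Metric.nhds_basis_closedBall.mem_iff.1
    (inter_mem (inter_mem hU hs) hgrow)
  have hrU : closedBall p r ⊆ U := fun z hz => (hball hz).1.1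
  have hrK : LipschitzOnWith K F (closedBall p r) := hK.mono fun z hz => (hball hz).1.2
  obtain ⟨δ, hδ, hstay⟩ := hst r hr
  -- an initial point close to `p` where the form is positive
  obtain ⟨c, hc, hcδ⟩ : ∃ c : ℝ, 0 < c ∧ c * ‖w‖ < min δ r := by
    have hm : 0 < min δ r := lt_min hδ hr
    refine ⟨min δ r / (‖w‖ + 1), by positivity, ?_⟩
    rw [div_mul_eq_mul_div, div_lt_iff₀ (by positivity)]
    nlinarith
  set z₀ := p + c • w
  have hz₀ : ‖z₀ - p‖ = c * ‖w‖ := by simp [z₀, norm_smul, abs_of_pos hc]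
  set V : ℝ := B (z₀ - p) (z₀ - p) with hVdef
  have hV : 0 < V := by
    have : V = c * (c * B w w) := by simp [hVdef, z₀]
    rw [this]
    positivity
  obtain ⟨τ, hτ0, hτ⟩ : ∃ τ : ℝ, 0 ≤ τ ∧ ‖B‖ * r * r < V * Real.exp (2 * σ * τ) := by
    -- Chosen so that `exp s ≥ 1 + s` already gives `V * exp (2στ) ≥ V + ‖B‖ r²`.
    refine ⟨‖B‖ * r * r / (V * (2 * σ)), by positivity, ?_⟩
    have h1 := Real.add_one_le_exp (2 * σ * (‖B‖ * r * r / (V * (2 * σ))))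
    have h2 : V * (2 * σ * (‖B‖ * r * r / (V * (2 * σ)))) = ‖B‖ * r * r := by
      field_simp
    nlinarith
  have hst' : ∀ τ ≥ 0, ∀ z : ℝ → ι → ℝ, IsSolutionOn F U τ z → z 0 = z₀ →
      ∀ t ∈ Icc 0 τ, z t ∈ ball p r := fun τ hτ z hz h0 t ht => by
    rw [mem_ball, dist_eq_norm]
    refine hstay τ hτ z hz ?_ t ht
    rw [h0, hz₀]
    exact hcδ.trans_le (min_le_left _ _)
  -- `LyapunovStable` only constrains solutions that exist; its own bound is what supplies one as
  -- long as `τ`.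
  obtain ⟨z, hz0, hz⟩ := exists_solution_of_forall_mem_ball hrK hrU
    (by rw [mem_ball, dist_eq_norm, hz₀]; exact hcδ.trans_le (min_le_right _ _)) hst' hτ0
  have hin := hst' τ hτ0 z hz hz0
  set φ : ℝ → ℝ := fun t => B (z t - p) (z t - p) * Real.exp (-(2 * σ * t)) with hφ
  have hder : ∀ t ∈ Icc 0 τ, HasDerivWithinAt φ
      ((B (F (z t)) (z t - p) + B (z t - p) (F (z t))) * Real.exp (-(2 * σ * t)) +
        B (z t - p) (z t - p) * (Real.exp (-(2 * σ * t)) * -(2 * σ))) (Icc 0 τ) t := by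
    intro t ht
    have h1 : HasDerivWithinAt (fun t => z t - p) (F (z t)) (Icc 0 τ) t := (hz t ht).2.sub_const p
    have h2 : HasDerivWithinAt (fun t => B (z t - p)) (B (F (z t))) (Icc 0 τ) t :=
      B.hasFDerivAt.comp_hasDerivWithinAt t h1
    have h3 : HasDerivAt (fun t : ℝ => Real.exp (-(2 * σ * t)))
        (Real.exp (-(2 * σ * t)) * -(2 * σ)) t := by
      have := ((hasDerivAt_id t).const_mul (2 * σ)).neg.exp
      simpa using this
    exact (h2.clm_apply h1).mul h3.hasDerivWithinAt
  have hmono : MonotoneOn φ (Icc 0 τ) := by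
    refine monotoneOn_of_hasDerivWithinAt_nonneg (convex_Icc 0 τ)
      (fun t ht => (hder t ht).continuousWithinAt)
      (fun t ht => (hder t (interior_subset ht)).mono interior_subset) fun t ht => ?_
    have hg : 2 * σ * B (z t - p) (z t - p) ≤ B (F (z t)) (z t - p) + B (z t - p) (F (z t)) :=
      (hball (ball_subset_closedBall (hin t (interior_subset ht)))).2
    nlinarith [Real.exp_pos (-(2 * σ * t))]
  have h1 := hmono (left_mem_Icc.2 hτ0) (right_mem_Icc.2 hτ0) hτ0
  simp only [hφ, hz0, mul_zero, neg_zero, Real.exp_zero, mul_one] at h1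
  have h2 : B (z τ - p) (z τ - p) ≤ ‖B‖ * r * r := by
    have hzr : ‖z τ - p‖ ≤ r := by
      have := (mem_ball.1 (hin τ (right_mem_Icc.2 hτ0))).le
      rwa [dist_eq_norm] at this
    calc B (z τ - p) (z τ - p) ≤ ‖B (z τ - p) (z τ - p)‖ := Real.le_norm_self _
      _ ≤ ‖B‖ * ‖z τ - p‖ * ‖z τ - p‖ := B.le_opNorm₂ _ _
      _ ≤ ‖B‖ * r * r := by gcongr
  have h3 : V * Real.exp (2 * σ * τ) ≤ B (z τ - p) (z τ - p) := by
    rw [Real.exp_neg] at h1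
    exact (le_mul_inv_iff₀ (Real.exp_pos _)).1 h1
  linarith

end Instability

noncomputable section

/-! ### Roots in the right half-plane from the signs of low coefficients. -/

section QuarticRoots

/-- A real polynomial with positive leading coefficient that is negative at `0` has a positive
root. -/
theorem Polynomial.exists_pos_root_of_eval_zero_neg {p : ℝ[X]} (hlead : 0 ≤ p.leadingCoeff)
    (hdeg : 0 < p.degree) (h0 : p.eval 0 < 0) : ∃ t, 0 < t ∧ p.eval t = 0 := by
  have htend := p.tendsto_atTop_of_leadingCoeff_nonneg hdeg hlead
  obtain ⟨s, hs, hs0⟩ := ((htend.eventually_ge_atTop 0).and (Filter.eventually_ge_atTop 0)).exists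
  obtain ⟨t, ht, htp⟩ := intermediate_value_Icc hs0 p.continuous.continuousOn ⟨h0.le, hs⟩
  refine ⟨t, lt_of_le_of_ne ht.1 ?_, htp⟩
  rintro rfl
  exact h0.ne htp

/-- A real polynomial of degree at least two with positive leading coefficient and negative constant
or linear coefficient has a complex root with positive real part. -/
theorem Polynomial.exists_root_re_pos {p : ℝ[X]} (hlead : 0 ≤ p.leadingCoeff)
    (hdeg : 2 ≤ p.natDegree) (h : p.coeff 0 < 0 ∨ p.coeff 1 < 0) :
    ∃ l : ℂ, aeval l p = 0 ∧ 0 < l.re := by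
  rcases h with h | h
  · obtain ⟨t, ht, hpt⟩ := p.exists_pos_root_of_eval_zero_neg hlead
      (natDegree_pos_iff_degree_pos.1 (by omega)) (by rwa [← coeff_zero_eq_eval_zero])
    refine ⟨t, ?_, by simpa using ht⟩
    have := aeval_algebraMap_apply ℂ t p
    simp only [Complex.coe_algebraMap] at this
    rw [this, coe_aeval_eq_eval, hpt, Complex.ofReal_zero]
  · have hnd : p.derivative.natDegree = p.natDegree - 1 := natDegree_derivative p
    have hl : p.derivative.leadingCoeff = p.leadingCoeff * p.natDegree := by
      rw [leadingCoeff, hnd, coeff_derivative, leadingCoeff, Nat.cast_sub (by omega),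
        Nat.sub_add_cancel (by omega)]
      simp
    obtain ⟨t, ht, hpt⟩ := p.derivative.exists_pos_root_of_eval_zero_neg
      (by rw [hl]; positivity) (natDegree_pos_iff_degree_pos.1 (by omega))
      (by rw [← coeff_zero_eq_eval_zero, coeff_derivative]; simpa using h)
    by_contra! hcon
    have hp : p ≠ 0 := by
      rintro rfl
      simp at hdeg
    set q : ℂ[X] := p.map (algebraMap ℝ ℂ)
    have hq0 : q ≠ 0 := (Polynomial.map_ne_zero_iff (algebraMap ℝ ℂ).injective).2 hp
    have hq : 0 < q.degree := by
      rw [degree_map]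
      exact natDegree_pos_iff_degree_pos.1 (by omega)
    have hroot : (t : ℂ) ∈ q.derivative.rootSet ℂ := by
      rw [mem_rootSet]
      constructor
      · intro hz
        have := natDegree_derivative q
        rw [hz, natDegree_map, natDegree_zero] at this
        omega
      · rw [derivative_map, aeval_map_algebraMap]
        have := aeval_algebraMap_apply ℂ t p.derivative
        simp only [Complex.coe_algebraMap] at this
        rw [this, coe_aeval_eq_eval, hpt, Complex.ofReal_zero]
    -- Gauss–Lucas: if all roots had nonpositive real part, so would the positive root `t` of the
    -- derivative.
    have hmem := rootSet_derivative_subset_convexHull_rootSet hq hroot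
    have hsub : convexHull ℝ (q.rootSet ℂ) ⊆ {z : ℂ | z.re ≤ 0} := by
      refine convexHull_min (fun z hz => ?_) (convex_halfSpace_re_le 0)
      refine hcon z ?_
      have := (mem_rootSet.1 hz).2
      rwa [aeval_map_algebraMap] at this
    have := hsub hmem
    simp only [Set.mem_ofPred_eq, Complex.ofReal_re] at this
    linarith

/-- The special case of a monic quartic. -/
theorem exists_root_re_pos_of_quartic {a b c d : ℝ} (h : d < 0 ∨ c < 0) :
    ∃ l : ℂ, aeval l (X ^ 4 + C a * X ^ 3 + C b * X ^ 2 + C c * X + C d : ℝ[X]) = 0 ∧ 0 < l.re := by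
  have hnd : (X ^ 4 + C a * X ^ 3 + C b * X ^ 2 + C c * X + C d : ℝ[X]).natDegree = 4 := by
    compute_degree!
  refine Polynomial.exists_root_re_pos ?_ (by omega) ?_
  · rw [leadingCoeff, hnd]
    simp
  · simpa using h

end QuarticRoots

/-! ### Derivatives of the forces at a rest point. -/

section Derivatives

theorem HasDerivAt.div_sqrt_pow {g q : ℝ → ℝ} {g' q' s : ℝ} (hg : HasDerivAt g g' s)
    (hq : HasDerivAt q q' s) (hs : √(q s) ≠ 0) (k : ℕ) :
    HasDerivAt (fun t => g t / √(q t) ^ (k + 1))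
      (g' / √(q s) ^ (k + 1) - (k + 1) / 2 * g s * q' / √(q s) ^ (k + 3)) s := by
  have hq0 : q s ≠ 0 := fun h => hs (by rw [h, Real.sqrt_zero])
  refine (hg.fun_div ((hq.sqrt hq0).fun_pow (k + 1)) (pow_ne_zero _ hs)).congr_deriv ?_
  push_cast
  field_simp
  ring

theorem HasDerivAt.sq_add_sq {g h : ℝ → ℝ} {g' h' s : ℝ} (hg : HasDerivAt g g' s)
    (hh : HasDerivAt h h' s) :
    HasDerivAt (fun t => g t ^ 2 + h t ^ 2) (2 * (g s * g' + h s * h')) s := by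
  refine ((hg.fun_pow 2).fun_add (hh.fun_pow 2)).congr_deriv ?_
  push_cast
  ring

end Derivatives

namespace Chermnykh

variable (P : Chermnykh)

/-- The entry `xx` of the Jacobian of the rest forces with respect to the position. -/
def jacXX (x y : ℝ) : ℝ :=
  P.n ^ 2 - P.coeffF x y
    + 3 * ((1 - P.mu) * P.q1 / P.r1 x y ^ 5 * (x + P.mu) ^ 2
      + P.mu * P.obl x y / P.r2 x y ^ 5 * (x + P.mu - 1) ^ 2 + P.Mb / P.rT x y ^ 5 * x ^ 2)
    - 2 * (P.W1 * P.n / P.r1 x y ^ 4) * (x + P.mu) * y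

/-- The off-diagonal entries of the Jacobian of the rest forces with respect to the position. -/
def jacXY (x y : ℝ) : ℝ :=
  3 * ((1 - P.mu) * P.q1 / P.r1 x y ^ 5 * ((x + P.mu) * y)
      + P.mu * P.obl x y / P.r2 x y ^ 5 * ((x + P.mu - 1) * y) + P.Mb / P.rT x y ^ 5 * (x * y))
    + P.W1 * P.n / P.r1 x y ^ 4 * ((x + P.mu) ^ 2 - y ^ 2)

/-- The entry `yy` of the Jacobian of the rest forces with respect to the position. -/
def jacYY (x y : ℝ) : ℝ :=
  P.n ^ 2 - P.coeffF x y
    + 3 * ((1 - P.mu) * P.q1 / P.r1 x y ^ 5 * y ^ 2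
      + P.mu * P.obl x y / P.r2 x y ^ 5 * y ^ 2 + P.Mb / P.rT x y ^ 5 * y ^ 2)
    + 2 * (P.W1 * P.n / P.r1 x y ^ 4) * (x + P.mu) * y

variable {P}

theorem r1_sq (x y : ℝ) : P.r1 x y ^ 2 = (x + P.mu) ^ 2 + y ^ 2 := Real.sq_sqrt (by positivity)

theorem r2_sq (x y : ℝ) : P.r2 x y ^ 2 = (x + P.mu - 1) ^ 2 + y ^ 2 := Real.sq_sqrt (by positivity)

theorem rT_sq (x y : ℝ) : P.rT x y ^ 2 = x ^ 2 + y ^ 2 + P.T ^ 2 := Real.sq_sqrt (by positivity)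

variable {x y : ℝ} {z : ℝ → Fin 4 → ℝ} {z' : Fin 4 → ℝ} {s : ℝ}

/-- Stated along an arbitrary curve so that coordinate curves give the partial derivatives and
straight lines give the Fréchet derivative. -/
theorem hasDerivAt_OmegaX (hp : ![x, y, 0, 0] ∈ P.phaseSpace) (hz : HasDerivAt z z' s)
    (hzs : z s = ![x, y, 0, 0]) :
    HasDerivAt (fun t => P.OmegaX (z t)) (P.jacXX x y * z' 0 + P.jacXY x y * z' 1
      - P.W1 / P.r1 x y ^ 2 * (1 + (x + P.mu) ^ 2 / P.r1 x y ^ 2) * z' 2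
      - P.W1 / P.r1 x y ^ 2 * ((x + P.mu) * y / P.r1 x y ^ 2) * z' 3) s := by
  obtain ⟨h1, h2, hT⟩ := hp
  simp only [Matrix.cons_val_zero, Matrix.cons_val_one] at h1 h2 hT
  have hi := hasDerivAt_pi.1 hz
  have e0 : z s 0 = x := by rw [hzs]; rfl
  have e1 : z s 1 = y := by rw [hzs]; rfl
  have e2 : z s 2 = 0 := by rw [hzs]; rfl
  have e3 : z s 3 = 0 := by rw [hzs]; rfl
  have hX : HasDerivAt (fun t => z t 0 + P.mu) (z' 0) s := (hi 0).add_const _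
  have hX1 : HasDerivAt (fun t => z t 0 + P.mu - 1) (z' 0) s := hX.sub_const _
  have q1 := hX.sq_add_sq (hi 1)
  have q2 := hX1.sq_add_sq (hi 1)
  have qT := ((hi 0).sq_add_sq (hi 1)).add_const (P.T ^ 2)
  have s1 : √((z s 0 + P.mu) ^ 2 + z s 1 ^ 2) ≠ 0 := by rw [e0, e1]; exact h1
  have s2 : √((z s 0 + P.mu - 1) ^ 2 + z s 1 ^ 2) ≠ 0 := by rw [e0, e1]; exact h2
  have t1 := (hX.const_mul ((1 - P.mu) * P.q1)).div_sqrt_pow q1 s1 2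
  have t2 := (hX1.const_mul P.mu).div_sqrt_pow q2 s2 2
  have t3 := ((hX1.const_mul (P.mu * P.A2)).div_sqrt_pow q2 s2 4).const_mul (3 / 2)
  simp only [← mul_div_assoc] at t3
  have t4 : HasDerivAt (fun t => P.Mb * z t 0 / P.rT (z t 0) (z t 1) ^ 3)
      (P.Mb * z' 0 / P.rT x y ^ 3 - 3 * P.Mb * x * (x * z' 0 + y * z' 1) / P.rT x y ^ 5) s := by
    by_cases hM : P.Mb = 0
    -- With no belt mass, `rT` may vanish here, but the term is identically zero.
    · simpa [hM] using hasDerivAt_const s (0 : ℝ)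
    · have sT : √(z s 0 ^ 2 + z s 1 ^ 2 + P.T ^ 2) ≠ 0 := by rw [e0, e1]; exact hT hM
      refine (((hi 0).const_mul P.Mb).div_sqrt_pow qT sT 2).congr_deriv ?_
      rw [e0, e1, ← rT]
      push_cast
      ring
  have t5 := (hasDerivAt_const s P.W1).div_sqrt_pow q1 s1 1
  have t6 := hX.div_sqrt_pow q1 s1 1
  have t7 := ((t6.fun_mul ((hX.fun_mul (hi 2)).fun_add ((hi 1).fun_mul (hi 3)))).fun_add
    (hi 2)).fun_sub ((hi 1).const_mul P.n)
  refine HasDerivAt.congr_deriv (f := fun t => P.OmegaX (z t))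
    ((((((hi 0).const_mul (P.n ^ 2)).fun_sub t1).fun_sub t2).fun_sub t3).fun_sub t4 |>.fun_sub
      (t5.fun_mul t7)) ?_
  rw [e0, e1, e2, e3]
  simp only [← r1.eq_1, ← r2.eq_1]
  -- Puts the drag part of the `xy` entry over `r₁⁴`, where it takes the symmetric form of `jacXY`.
  have hk : P.W1 / P.r1 x y ^ 2 = P.W1 / P.r1 x y ^ 4 * ((x + P.mu) ^ 2 + y ^ 2) := by
    rw [← r1_sq]
    field_simp
  rw [jacXX, jacXY, coeffF, obl]
  push_cast
  linear_combination (P.n * z' 1) * hk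

theorem hasDerivAt_OmegaY (hp : ![x, y, 0, 0] ∈ P.phaseSpace) (hz : HasDerivAt z z' s)
    (hzs : z s = ![x, y, 0, 0]) :
    HasDerivAt (fun t => P.OmegaY (z t)) (P.jacXY x y * z' 0 + P.jacYY x y * z' 1
      - P.W1 / P.r1 x y ^ 2 * ((x + P.mu) * y / P.r1 x y ^ 2) * z' 2
      - P.W1 / P.r1 x y ^ 2 * (1 + y ^ 2 / P.r1 x y ^ 2) * z' 3) s := by
  obtain ⟨h1, h2, hT⟩ := hp
  simp only [Matrix.cons_val_zero, Matrix.cons_val_one] at h1 h2 hT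
  have hi := hasDerivAt_pi.1 hz
  have e0 : z s 0 = x := by rw [hzs]; rfl
  have e1 : z s 1 = y := by rw [hzs]; rfl
  have e2 : z s 2 = 0 := by rw [hzs]; rfl
  have e3 : z s 3 = 0 := by rw [hzs]; rfl
  have hX : HasDerivAt (fun t => z t 0 + P.mu) (z' 0) s := (hi 0).add_const _
  have hX1 : HasDerivAt (fun t => z t 0 + P.mu - 1) (z' 0) s := hX.sub_const _
  have q1 := hX.sq_add_sq (hi 1)
  have q2 := hX1.sq_add_sq (hi 1)
  have qT := ((hi 0).sq_add_sq (hi 1)).add_const (P.T ^ 2)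
  have s1 : √((z s 0 + P.mu) ^ 2 + z s 1 ^ 2) ≠ 0 := by rw [e0, e1]; exact h1
  have s2 : √((z s 0 + P.mu - 1) ^ 2 + z s 1 ^ 2) ≠ 0 := by rw [e0, e1]; exact h2
  have t1 := ((hi 1).const_mul ((1 - P.mu) * P.q1)).div_sqrt_pow q1 s1 2
  have t2 := ((hi 1).const_mul P.mu).div_sqrt_pow q2 s2 2
  have t3 := (((hi 1).const_mul (P.mu * P.A2)).div_sqrt_pow q2 s2 4).const_mul (3 / 2)
  simp only [← mul_div_assoc] at t3
  have t4 : HasDerivAt (fun t => P.Mb * z t 1 / P.rT (z t 0) (z t 1) ^ 3)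
      (P.Mb * z' 1 / P.rT x y ^ 3 - 3 * P.Mb * y * (x * z' 0 + y * z' 1) / P.rT x y ^ 5) s := by
    by_cases hM : P.Mb = 0
    · simpa [hM] using hasDerivAt_const s (0 : ℝ)
    · have sT : √(z s 0 ^ 2 + z s 1 ^ 2 + P.T ^ 2) ≠ 0 := by rw [e0, e1]; exact hT hM
      refine (((hi 1).const_mul P.Mb).div_sqrt_pow qT sT 2).congr_deriv ?_
      rw [e0, e1, ← rT]
      push_cast
      ring
  have t5 := (hasDerivAt_const s P.W1).div_sqrt_pow q1 s1 1
  have t6 := (hi 1).div_sqrt_pow q1 s1 1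
  have t7 := ((t6.fun_mul ((hX.fun_mul (hi 2)).fun_add ((hi 1).fun_mul (hi 3)))).fun_add
    (hi 3)).fun_add (hX.const_mul P.n)
  refine HasDerivAt.congr_deriv (f := fun t => P.OmegaY (z t))
    ((((((hi 1).const_mul (P.n ^ 2)).fun_sub t1).fun_sub t2).fun_sub t3).fun_sub t4 |>.fun_sub
      (t5.fun_mul t7)) ?_
  rw [e0, e1, e2, e3]
  simp only [← r1.eq_1, ← r2.eq_1]
  have hk : P.W1 / P.r1 x y ^ 2 = P.W1 / P.r1 x y ^ 4 * ((x + P.mu) ^ 2 + y ^ 2) := by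
    rw [← r1_sq]
    field_simp
  rw [jacXY, jacYY, coeffF, obl]
  push_cast
  linear_combination (-(P.n * z' 0)) * hk

end Chermnykh
end

noncomputable section

/-! ### Linear algebra of the gyroscopic system. -/

/-- A real symmetric `2 × 2` matrix with positive trace, the quadratic form of which takes a negative
value, has a negative determinant. -/
theorem det_neg_of_trace_pos_of_form_neg {m₁ m₂ m₃ s t : ℝ} (htr : 0 < m₁ + m₃)
    (hneg : s ^ 2 * m₁ + 2 * (s * t) * m₂ + t ^ 2 * m₃ < 0) : m₁ * m₃ - m₂ ^ 2 < 0 := by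
  by_contra! h
  -- Completing the square: `m₁` times the form is `(s m₁ + t m₂)² + t² (m₁ m₃ - m₂²)`, and
  -- symmetrically for `m₃`; one of the two entries is positive.
  rcases lt_or_ge 0 m₁ with h1 | h1
  · nlinarith [mul_pos h1 (neg_pos.2 hneg), sq_nonneg (s * m₁ + t * m₂),
      mul_nonneg (sq_nonneg t) h]
  · have h3 : 0 < m₃ := by linarith
    nlinarith [mul_pos h3 (neg_pos.2 hneg), sq_nonneg (t * m₃ + s * m₂),
      mul_nonneg (sq_nonneg s) h]

/-- The characteristic determinant of a gyroscopic system with two degrees of freedom and symmetric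
stiffness and damping matrices. -/
theorem det_gyroscopic (n d₁ d₂ d₃ m₁ m₂ m₃ : ℝ) :
    Matrix.det !![X ^ 2 - X * C d₁ - C m₁, -(2 * C n + C d₂) * X - C m₂;
      (2 * C n - C d₂) * X - C m₂, X ^ 2 - X * C d₃ - C m₃] =
    X ^ 4 + C (-(d₁ + d₃)) * X ^ 3 + C (4 * n ^ 2 - d₂ ^ 2 + d₁ * d₃ - m₁ - m₃) * X ^ 2
      + C (d₁ * m₃ + d₃ * m₁ - 2 * d₂ * m₂) * X + C (m₁ * m₃ - m₂ ^ 2) := by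
  rw [Matrix.det_fin_two_of]
  simp only [map_neg, map_add, map_sub, map_mul, map_pow, map_ofNat]
  ring

/-- A characteristic root of a gyroscopic system is an eigenvalue of the associated first-order
system. -/
theorem exists_eigenvector_of_gyroscopic {n d₁ d₂ d₃ m₁ m₂ m₃ : ℝ} {l : ℂ}
    {A : (Fin 4 → ℝ) → Fin 4 → ℝ}
    (hA : ∀ w, A w = ![w 2, w 3, 2 * n * w 3 + (m₁ * w 0 + m₂ * w 1 + d₁ * w 2 + d₂ * w 3),
      -(2 * n * w 2) + (m₂ * w 0 + m₃ * w 1 + d₂ * w 2 + d₃ * w 3)])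
    (hl : aeval l (Matrix.det !![X ^ 2 - X * C d₁ - C m₁, -(2 * C n + C d₂) * X - C m₂;
      (2 * C n - C d₂) * X - C m₂, X ^ 2 - X * C d₃ - C m₃]) = 0) :
    ∃ u v, A u = l.re • u - l.im • v ∧ A v = l.re • v + l.im • u ∧ (u ≠ 0 ∨ v ≠ 0) := by
  have hdet : Matrix.det !![l ^ 2 - l * d₁ - m₁, -(2 * n + d₂) * l - m₂;
      (2 * n - d₂) * l - m₂, l ^ 2 - l * d₃ - (m₃ : ℂ)] = 0 := by
    rw [Matrix.det_fin_two_of] at hl ⊢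
    simp [map_ofNat] at hl
    linear_combination hl
  obtain ⟨w, hw, hker⟩ := Matrix.exists_mulVec_eq_zero_iff.2 hdet
  have k0 := congrFun hker 0
  have k1 := congrFun hker 1
  simp only [Matrix.mulVec, dotProduct, Fin.sum_univ_two, Matrix.of_apply, Matrix.cons_val_zero,
    Matrix.cons_val_one, Matrix.cons_val', Matrix.cons_val_fin_one, Pi.zero_apply] at k0 k1
  generalize hξ : w 0 = ξ at k0 k1
  generalize hη : w 1 = η at k0 k1
  have j0 : 2 * n * (l * η) + (m₁ * ξ + m₂ * η + d₁ * (l * ξ) + d₂ * (l * η)) = l * (l * ξ) := by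
    linear_combination -k0
  have j1 : -(2 * n * (l * ξ)) + (m₂ * ξ + m₃ * η + d₂ * (l * ξ) + d₃ * (l * η)) = l * (l * η) := by
    linear_combination -k1
  -- Real and imaginary parts of the complex eigenvector `(ξ, η, l ξ, l η)`.
  refine ⟨![ξ.re, η.re, (l * ξ).re, (l * η).re], ![ξ.im, η.im, (l * ξ).im, (l * η).im], ?_, ?_, ?_⟩
  · have i0 := congrArg Complex.re j0
    have i1 := congrArg Complex.re j1
    rw [hA]
    ext i
    fin_cases i
    · simp [Complex.mul_re]
    · simp [Complex.mul_re]
    · simp at i0 ⊢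
      linarith
    · simp at i1 ⊢
      linarith
  · have i0 := congrArg Complex.im j0
    have i1 := congrArg Complex.im j1
    rw [hA]
    ext i
    fin_cases i
    · simp [Complex.mul_im]
    · simp [Complex.mul_im]
    · simp at i0 ⊢
      linarith
    · simp at i1 ⊢
      linarith
  · by_contra! h
    refine hw ?_
    have a0 := congrFun h.1 0
    have a1 := congrFun h.1 1
    have b0 := congrFun h.2 0
    have b1 := congrFun h.2 1
    simp only [Matrix.cons_val_zero, Matrix.cons_val_one, Pi.zero_apply] at a0 a1 b0 b1
    ext i
    fin_cases i
    · exact hξ.trans (Complex.ext a0 b0)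
    · exact hη.trans (Complex.ext a1 b1)

/-! ### Smoothness of the vector field and its linearisation. -/

namespace Chermnykh

variable {P : Chermnykh} {x y : ℝ}

theorem contDiffAt_r1 {z : Fin 4 → ℝ} (h : P.r1 (z 0) (z 1) ≠ 0) :
    ContDiffAt ℝ 1 (fun z : Fin 4 → ℝ => P.r1 (z 0) (z 1)) z :=
  ContDiffAt.sqrt (by fun_prop) fun h0 => h (by rw [r1, h0, Real.sqrt_zero])

theorem contDiffAt_r2 {z : Fin 4 → ℝ} (h : P.r2 (z 0) (z 1) ≠ 0) :
    ContDiffAt ℝ 1 (fun z : Fin 4 → ℝ => P.r2 (z 0) (z 1)) z :=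
  ContDiffAt.sqrt (by fun_prop) fun h0 => h (by rw [r2, h0, Real.sqrt_zero])

theorem contDiffAt_rT {z : Fin 4 → ℝ} (h : P.rT (z 0) (z 1) ≠ 0) :
    ContDiffAt ℝ 1 (fun z : Fin 4 → ℝ => P.rT (z 0) (z 1)) z :=
  ContDiffAt.sqrt (by fun_prop) fun h0 => h (by rw [rT, h0, Real.sqrt_zero])

theorem contDiffAt_belt {z : Fin 4 → ℝ} (h : P.Mb ≠ 0 → P.rT (z 0) (z 1) ≠ 0) (i : Fin 4) :
    ContDiffAt ℝ 1 (fun z : Fin 4 → ℝ => P.Mb * z i / P.rT (z 0) (z 1) ^ 3) z := by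
  by_cases hM : P.Mb = 0
  · simpa [hM] using contDiffAt_const
  · exact ContDiffAt.div (by fun_prop) ((contDiffAt_rT (h hM)).pow 3) (pow_ne_zero _ (h hM))

theorem contDiffAt_OmegaX {z : Fin 4 → ℝ} (hz : z ∈ P.phaseSpace) :
    ContDiffAt ℝ 1 P.OmegaX z := by
  obtain ⟨h1, h2, hT⟩ := hz
  have c1 := contDiffAt_r1 h1
  have c2 := contDiffAt_r2 h2
  have c4 := contDiffAt_belt hT 0
  have t1 : ContDiffAt ℝ 1 (fun z : Fin 4 → ℝ =>
      (1 - P.mu) * P.q1 * (z 0 + P.mu) / P.r1 (z 0) (z 1) ^ 3) z :=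
    ContDiffAt.div (by fun_prop) (c1.pow 3) (pow_ne_zero _ h1)
  have t2 : ContDiffAt ℝ 1 (fun z : Fin 4 → ℝ =>
      P.mu * (z 0 + P.mu - 1) / P.r2 (z 0) (z 1) ^ 3) z :=
    ContDiffAt.div (by fun_prop) (c2.pow 3) (pow_ne_zero _ h2)
  have t3 : ContDiffAt ℝ 1 (fun z : Fin 4 → ℝ =>
      3 / 2 * (P.mu * P.A2 * (z 0 + P.mu - 1)) / P.r2 (z 0) (z 1) ^ 5) z :=
    ContDiffAt.div (by fun_prop) (c2.pow 5) (pow_ne_zero _ h2)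
  have t5 : ContDiffAt ℝ 1 (fun z : Fin 4 → ℝ => P.W1 / P.r1 (z 0) (z 1) ^ 2) z :=
    ContDiffAt.div (by fun_prop) (c1.pow 2) (pow_ne_zero _ h1)
  have t6 : ContDiffAt ℝ 1 (fun z : Fin 4 → ℝ => (z 0 + P.mu) / P.r1 (z 0) (z 1) ^ 2) z :=
    ContDiffAt.div (by fun_prop) (c1.pow 2) (pow_ne_zero _ h1)
  have t7 : ContDiffAt ℝ 1 (fun z : Fin 4 → ℝ =>
      (z 0 + P.mu) / P.r1 (z 0) (z 1) ^ 2 * ((z 0 + P.mu) * z 2 + z 1 * z 3) + z 2 - P.n * z 1) z :=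
    ((t6.mul (by fun_prop)).add (by fun_prop)).sub (by fun_prop)
  have t0 : ContDiffAt ℝ 1 (fun z : Fin 4 → ℝ => P.n ^ 2 * z 0) z := by fun_prop
  exact ((((t0.sub t1).sub t2).sub t3).sub c4).sub (t5.mul t7)

theorem contDiffAt_OmegaY {z : Fin 4 → ℝ} (hz : z ∈ P.phaseSpace) :
    ContDiffAt ℝ 1 P.OmegaY z := by
  obtain ⟨h1, h2, hT⟩ := hz
  have c1 := contDiffAt_r1 h1
  have c2 := contDiffAt_r2 h2
  have c4 := contDiffAt_belt hT 1
  have t1 : ContDiffAt ℝ 1 (fun z : Fin 4 → ℝ =>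
      (1 - P.mu) * P.q1 * z 1 / P.r1 (z 0) (z 1) ^ 3) z :=
    ContDiffAt.div (by fun_prop) (c1.pow 3) (pow_ne_zero _ h1)
  have t2 : ContDiffAt ℝ 1 (fun z : Fin 4 → ℝ => P.mu * z 1 / P.r2 (z 0) (z 1) ^ 3) z :=
    ContDiffAt.div (by fun_prop) (c2.pow 3) (pow_ne_zero _ h2)
  have t3 : ContDiffAt ℝ 1 (fun z : Fin 4 → ℝ =>
      3 / 2 * (P.mu * P.A2 * z 1) / P.r2 (z 0) (z 1) ^ 5) z :=
    ContDiffAt.div (by fun_prop) (c2.pow 5) (pow_ne_zero _ h2)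
  have t5 : ContDiffAt ℝ 1 (fun z : Fin 4 → ℝ => P.W1 / P.r1 (z 0) (z 1) ^ 2) z :=
    ContDiffAt.div (by fun_prop) (c1.pow 2) (pow_ne_zero _ h1)
  have t6 : ContDiffAt ℝ 1 (fun z : Fin 4 → ℝ => z 1 / P.r1 (z 0) (z 1) ^ 2) z :=
    ContDiffAt.div (by fun_prop) (c1.pow 2) (pow_ne_zero _ h1)
  have t7 : ContDiffAt ℝ 1 (fun z : Fin 4 → ℝ =>
      z 1 / P.r1 (z 0) (z 1) ^ 2 * ((z 0 + P.mu) * z 2 + z 1 * z 3) + z 3 + P.n * (z 0 + P.mu)) z :=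
    ((t6.mul (by fun_prop)).add (by fun_prop)).add (by fun_prop)
  have t0 : ContDiffAt ℝ 1 (fun z : Fin 4 → ℝ => P.n ^ 2 * z 1) z := by fun_prop
  exact ((((t0.sub t1).sub t2).sub t3).sub c4).sub (t5.mul t7)

theorem contDiffAt_field {z : Fin 4 → ℝ} (hz : z ∈ P.phaseSpace) : ContDiffAt ℝ 1 P.field z := by
  have hX := contDiffAt_OmegaX hz
  have hY := contDiffAt_OmegaY hz
  rw [contDiffAt_pi]
  intro i
  fin_cases i
  · change ContDiffAt ℝ 1 (fun z : Fin 4 → ℝ => z 2) z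
    fun_prop
  · change ContDiffAt ℝ 1 (fun z : Fin 4 → ℝ => z 3) z
    fun_prop
  · change ContDiffAt ℝ 1 (fun z : Fin 4 → ℝ => 2 * P.n * z 3 + P.OmegaX z) z
    fun_prop
  · change ContDiffAt ℝ 1 (fun z : Fin 4 → ℝ => -(2 * P.n * z 2) + P.OmegaY z) z
    fun_prop

theorem phaseSpace_mem_nhds {z : Fin 4 → ℝ} (hz : z ∈ P.phaseSpace) : P.phaseSpace ∈ nhds z := by
  obtain ⟨h1, h2, hT⟩ := hz
  filter_upwards [(contDiffAt_r1 h1).continuousAt.eventually_ne h1,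
    (contDiffAt_r2 h2).continuousAt.eventually_ne h2,
    show ∀ᶠ w in nhds z, P.Mb ≠ 0 → P.rT (w 0) (w 1) ≠ 0 by
      by_cases hM : P.Mb = 0
      · simp [hM]
      · filter_upwards [(contDiffAt_rT (hT hM)).continuousAt.eventually_ne (hT hM)] with w hw _
        exact hw] with w a b c
  exact ⟨a, b, c⟩

theorem partialAt_OmegaX (hp : ![x, y, 0, 0] ∈ P.phaseSpace) (i : Fin 4) :
    partialAt P.OmegaX i ![x, y, 0, 0] = (![P.jacXX x y, P.jacXY x y,
      -(P.W1 / P.r1 x y ^ 2 * (1 + (x + P.mu) ^ 2 / P.r1 x y ^ 2)),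
      -(P.W1 / P.r1 x y ^ 2 * ((x + P.mu) * y / P.r1 x y ^ 2))] : Fin 4 → ℝ) i := by
  refine (hasDerivAt_OmegaX hp (hasDerivAt_update ![x, y, 0, 0] i _)
    (Function.update_eq_self _ _)).deriv.trans ?_
  fin_cases i <;> simp

theorem partialAt_OmegaY (hp : ![x, y, 0, 0] ∈ P.phaseSpace) (i : Fin 4) :
    partialAt P.OmegaY i ![x, y, 0, 0] = (![P.jacXY x y, P.jacYY x y,
      -(P.W1 / P.r1 x y ^ 2 * ((x + P.mu) * y / P.r1 x y ^ 2)),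
      -(P.W1 / P.r1 x y ^ 2 * (1 + y ^ 2 / P.r1 x y ^ 2))] : Fin 4 → ℝ) i := by
  refine (hasDerivAt_OmegaY hp (hasDerivAt_update ![x, y, 0, 0] i _)
    (Function.update_eq_self _ _)).deriv.trans ?_
  fin_cases i <;> simp

theorem fderiv_field_apply (hp : ![x, y, 0, 0] ∈ P.phaseSpace) (w : Fin 4 → ℝ) :
    fderiv ℝ P.field ![x, y, 0, 0] w = ![w 2, w 3,
      2 * P.n * w 3 + (P.jacXX x y * w 0 + P.jacXY x y * w 1
        + -(P.W1 / P.r1 x y ^ 2 * (1 + (x + P.mu) ^ 2 / P.r1 x y ^ 2)) * w 2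
        + -(P.W1 / P.r1 x y ^ 2 * ((x + P.mu) * y / P.r1 x y ^ 2)) * w 3),
      -(2 * P.n * w 2) + (P.jacXY x y * w 0 + P.jacYY x y * w 1
        + -(P.W1 / P.r1 x y ^ 2 * ((x + P.mu) * y / P.r1 x y ^ 2)) * w 2
        + -(P.W1 / P.r1 x y ^ 2 * (1 + y ^ 2 / P.r1 x y ^ 2)) * w 3)] := by
  have hF := ((contDiffAt_field hp).differentiableAt one_ne_zero).hasFDerivAt
  set p : Fin 4 → ℝ := ![x, y, 0, 0]
  have hline : HasDerivAt (fun t : ℝ => p + t • w) w 0 := by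
    simpa using ((hasDerivAt_id (0 : ℝ)).smul_const w).const_add p
  have h0 : p + (0 : ℝ) • w = p := by simp
  have hcomp : HasDerivAt (fun t : ℝ => P.field (p + t • w)) (fderiv ℝ P.field p w) 0 :=
    HasFDerivAt.comp_hasDerivAt (l := P.field) (0 : ℝ) (by rwa [h0]) hline
  have hi := hasDerivAt_pi.1 hline
  -- The derivative along the line `p + t w` is unique, so the curve lemmas determine the Fréchet
  -- derivative in direction `w`.
  refine hcomp.unique (hasDerivAt_pi.2 fun i => ?_)
  fin_cases i
  · exact hi 2
  · exact hi 3
  · refine (((hi 3).const_mul (2 * P.n)).fun_add (hasDerivAt_OmegaX hp hline h0)).congr_deriv ?_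
    simp only [Fin.reduceFinMk, Matrix.cons_val]
    ring
  · refine (((hi 2).const_mul (2 * P.n)).fun_neg.fun_add
      (hasDerivAt_OmegaY hp hline h0)).congr_deriv ?_
    simp only [Fin.reduceFinMk, Matrix.cons_val]
    ring

theorem charDet_eq (hp : ![x, y, 0, 0] ∈ P.phaseSpace) :
    P.charDet x y = Matrix.det
      !![X ^ 2 - X * C (-(P.W1 / P.r1 x y ^ 2 * (1 + (x + P.mu) ^ 2 / P.r1 x y ^ 2)))
          - C (P.jacXX x y),
        -(2 * C P.n + C (-(P.W1 / P.r1 x y ^ 2 * ((x + P.mu) * y / P.r1 x y ^ 2)))) * X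
          - C (P.jacXY x y);
        (2 * C P.n - C (-(P.W1 / P.r1 x y ^ 2 * ((x + P.mu) * y / P.r1 x y ^ 2)))) * X
          - C (P.jacXY x y),
        X ^ 2 - X * C (-(P.W1 / P.r1 x y ^ 2 * (1 + y ^ 2 / P.r1 x y ^ 2)))
          - C (P.jacYY x y)] := by
  simp only [charDet, partialAt_OmegaX hp, partialAt_OmegaY hp, Matrix.cons_val]

/-! ### Closed forms of the coefficients of the quartic. -/

section Coefficients

/-- Each attracting body contributes a rank-one matrix `g v vᵀ` to the Jacobian, `v` being the
vector from the body. This lemma and the next two evaluate the traces `g |v|²`. Oblateness and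
softening are what separate these traces from the corresponding terms of `coeffF`. -/
theorem gravity₁_eq (h1 : P.r1 x y ≠ 0) :
    (1 - P.mu) * P.q1 / P.r1 x y ^ 5 * ((x + P.mu) ^ 2 + y ^ 2)
      = (1 - P.mu) * P.q1 / P.r1 x y ^ 3 := by
  rw [← r1_sq]
  field_simp

theorem gravity₂_eq (h2 : P.r2 x y ≠ 0) :
    P.mu * P.obl x y / P.r2 x y ^ 5 * ((x + P.mu - 1) ^ 2 + y ^ 2)
      = P.mu / P.r2 x y ^ 3 * (1 + 3 / 2 * P.A2 / P.r2 x y ^ 2) + P.mu * P.A2 / P.r2 x y ^ 5 := by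
  rw [← r2_sq, obl]
  field_simp
  ring

theorem gravity_belt_eq (hT : P.Mb ≠ 0 → P.rT x y ≠ 0) :
    P.Mb / P.rT x y ^ 5 * (x ^ 2 + y ^ 2 + P.T ^ 2) = P.Mb / P.rT x y ^ 3 := by
  rw [← rT_sq]
  by_cases hM : P.Mb = 0
  · simp [hM]
  · have := hT hM
    field_simp

variable (hp : ![x, y, 0, 0] ∈ P.phaseSpace)
include hp

theorem jac_trace : P.jacXX x y + P.jacYY x y = 2 * P.n ^ 2 + P.coeffF x y
    + 3 * P.mu * P.A2 / P.r2 x y ^ 5 - 3 * P.Mb * P.T ^ 2 / P.rT x y ^ 5 := by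
  have e1 := gravity₁_eq hp.1
  have e2 := gravity₂_eq hp.2.1
  have e3 := gravity_belt_eq hp.2.2
  simp only [Matrix.cons_val_zero, Matrix.cons_val_one] at e1 e2 e3
  rw [jacXX, jacYY, coeffF]
  linear_combination 3 * e1 + 3 * e2 + 3 * e3

/-- The form is evaluated on the tangential vector `(-y, x + μ)`. Its products with the vectors from
the two primaries and the barycentre are `0`, `y` and `μ y`, the origin of the `y²` terms of
`coeffE`; the drag part cancels. -/
theorem jac_form : y ^ 2 * P.jacXX x y + 2 * (-y * (x + P.mu)) * P.jacXY x y
      + (x + P.mu) ^ 2 * P.jacYY x y =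
    P.r1 x y ^ 2 * (3 * (P.n ^ 2 + P.coeffE x y) - (P.jacXX x y + P.jacYY x y)) := by
  have h1 := hp.1
  simp only [Matrix.cons_val_zero, Matrix.cons_val_one] at h1
  have hE : P.r1 x y ^ 2 * P.coeffE x y = P.r1 x y ^ 2 * (P.mu * P.A2 / P.r2 x y ^ 5)
      + P.mu * P.obl x y / P.r2 x y ^ 5 * y ^ 2
      + P.Mb / P.rT x y ^ 5 * (P.mu ^ 2 * y ^ 2 - P.r1 x y ^ 2 * P.T ^ 2) := by
    rw [coeffE]
    field_simp
  rw [jac_trace hp, jacXX, jacXY, jacYY]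
  linear_combination -3 * hE - (P.n ^ 2 - P.coeffF x y) * P.r1_sq x y

theorem coeffa_eq : P.coeffa x y =
    -(-(P.W1 / P.r1 x y ^ 2 * (1 + (x + P.mu) ^ 2 / P.r1 x y ^ 2))
      + -(P.W1 / P.r1 x y ^ 2 * (1 + y ^ 2 / P.r1 x y ^ 2))) := by
  have h1 := hp.1
  simp only [Matrix.cons_val_zero, Matrix.cons_val_one] at h1
  rw [coeffa]
  field_simp
  linear_combination P.W1 * P.r1_sq x y

/-- The damping determinant is `2 (W₁/r₁²)²`, since `I + û ûᵀ` has eigenvalues `1` and `2`. -/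
theorem coeffb_eq : P.coeffb x y = 4 * P.n ^ 2
    - (-(P.W1 / P.r1 x y ^ 2 * ((x + P.mu) * y / P.r1 x y ^ 2))) ^ 2
    + -(P.W1 / P.r1 x y ^ 2 * (1 + (x + P.mu) ^ 2 / P.r1 x y ^ 2))
      * -(P.W1 / P.r1 x y ^ 2 * (1 + y ^ 2 / P.r1 x y ^ 2)) - P.jacXX x y - P.jacYY x y := by
  have h1 := hp.1
  simp only [Matrix.cons_val_zero, Matrix.cons_val_one] at h1
  have hu : (x + P.mu) ^ 2 / P.r1 x y ^ 2 + y ^ 2 / P.r1 x y ^ 2 = 1 := by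
    rw [← add_div, ← r1_sq, div_self (pow_ne_zero _ h1)]
  rw [coeffb]
  linear_combination jac_trace hp - (P.W1 / P.r1 x y ^ 2) ^ 2 * hu

/-- The right side is `-(W₁/r₁²)` times the trace plus the normalised tangential form, so `jac_form`
turns it into a multiple of `n² + e`. -/
theorem coeffc_eq : P.coeffc x y =
    -(P.W1 / P.r1 x y ^ 2 * (1 + (x + P.mu) ^ 2 / P.r1 x y ^ 2)) * P.jacYY x y
    + -(P.W1 / P.r1 x y ^ 2 * (1 + y ^ 2 / P.r1 x y ^ 2)) * P.jacXX x y
    - 2 * -(P.W1 / P.r1 x y ^ 2 * ((x + P.mu) * y / P.r1 x y ^ 2)) * P.jacXY x y := by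
  have h1 := hp.1
  simp only [Matrix.cons_val_zero, Matrix.cons_val_one] at h1
  have hform := jac_form hp
  rw [coeffc, coeffa]
  field_simp
  linear_combination P.W1 * hform

/-- The products of distinct rank-one terms enter through squared cross products of the vectors from
the bodies, namely `y²`, `μ² y²` and `(1 - μ)² y²`. The drag part is trace-free and contributes `-n²
W₁² / r₁⁴` on its own. -/
theorem coeffd_eq : P.coeffd x y = P.jacXX x y * P.jacYY x y - P.jacXY x y ^ 2 := by
  have e1 := gravity₁_eq hp.1
  have e2 := gravity₂_eq hp.2.1
  have e3 := gravity_belt_eq hp.2.2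
  have h1 := hp.1
  simp only [Matrix.cons_val_zero, Matrix.cons_val_one] at e1 e2 e3 h1
  have hk : P.W1 * P.n / P.r1 x y ^ 4 * ((x + P.mu) ^ 2 + y ^ 2)
      = P.n * (P.W1 / P.r1 x y ^ 2) := by
    rw [← r1_sq]
    field_simp
  have hf : P.coeffF x y = (1 - P.mu) * P.q1 / P.r1 x y ^ 3
    + P.mu / P.r2 x y ^ 3 * (1 + 3 / 2 * P.A2 / P.r2 x y ^ 2) + P.Mb / P.rT x y ^ 3 := rfl
  rw [coeffd, jacXX, jacXY, jacYY]
  linear_combination -3 * (P.n ^ 2 - P.coeffF x y) * (e1 + e2 + e3 - hf)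
    + (P.W1 * P.n / P.r1 x y ^ 4 * ((x + P.mu) ^ 2 + y ^ 2)
      + P.n * (P.W1 / P.r1 x y ^ 2)) * hk

end Coefficients

/-! ### Signs of the coefficients and conclusion. -/

theorem n_sq_pos (hP : P.Admissible) : 0 < P.n ^ 2 := by
  have hA := hP.A2_nonneg
  have hM := hP.Mb_nonneg
  have hrc : 0 ≤ P.rc := Real.sqrt_nonneg _
  exact pow_pos (Real.sqrt_pos.2 (by positivity)) 2

theorem W1_pos (hP : P.Admissible) (hW : P.W1 ≠ 0) : 0 < P.W1 := by
  have h1 := hP.mu_lt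
  have h2 := hP.q1_le
  exact lt_of_le_of_ne (div_nonneg (mul_nonneg (by linarith) (by linarith)) hP.cd_pos.le) hW.symm

/-- The only negative term is the softening of the belt; `2T² ≤ r²` is exactly `3T² ≤ r² + T²`,
which lets the belt term of `coeffF` absorb it. -/
theorem jac_trace_pos (hP : P.Admissible) (hp : ![x, y, 0, 0] ∈ P.phaseSpace)
    (hcore : P.Mb ≠ 0 → 2 * P.T ^ 2 ≤ x ^ 2 + y ^ 2) : 0 < P.jacXX x y + P.jacYY x y := by
  have hn := n_sq_pos hP
  have hmu := hP.mu_pos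
  have hmu' : 0 ≤ 1 - P.mu := by linarith [hP.mu_lt]
  have hq := hP.q1_nonneg
  have hA := hP.A2_nonneg
  have hM := hP.Mb_nonneg
  have h1 : 0 ≤ P.r1 x y := Real.sqrt_nonneg _
  have h2 : 0 ≤ P.r2 x y := Real.sqrt_nonneg _
  have h3 : 0 ≤ P.rT x y := Real.sqrt_nonneg _
  have hbelt : 3 * P.Mb * P.T ^ 2 / P.rT x y ^ 5 ≤ P.Mb / P.rT x y ^ 3 := by
    rw [← gravity_belt_eq (x := x) (y := y) hp.2.2]
    by_cases hM0 : P.Mb = 0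
    · simp [hM0]
    · have hβ : 0 ≤ P.Mb / P.rT x y ^ 5 := by positivity
      have := mul_le_mul_of_nonneg_left (hcore hM0) hβ
      have e : 3 * P.Mb * P.T ^ 2 / P.rT x y ^ 5 = P.Mb / P.rT x y ^ 5 * (3 * P.T ^ 2) := by ring
      rw [e]
      linarith
  have g1 : 0 ≤ (1 - P.mu) * P.q1 / P.r1 x y ^ 3 := by positivity
  have g2 : 0 ≤ P.mu / P.r2 x y ^ 3 * (1 + 3 / 2 * P.A2 / P.r2 x y ^ 2) := by positivity
  have g3 : 0 ≤ 3 * P.mu * P.A2 / P.r2 x y ^ 5 := by positivity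
  rw [jac_trace hp, coeffF]
  linarith

theorem coeffa_pos (hP : P.Admissible) (hW : P.W1 ≠ 0) (h1 : P.r1 x y ≠ 0) :
    0 < P.coeffa x y :=
  div_pos (mul_pos three_pos (W1_pos hP hW))
    (pow_pos (lt_of_le_of_ne (Real.sqrt_nonneg _) h1.symm) 2)

theorem coeffd_neg_or_coeffc_neg (hP : P.Admissible) (hW : P.W1 ≠ 0)
    (hp : ![x, y, 0, 0] ∈ P.phaseSpace)
    (hcore : P.Mb ≠ 0 → 2 * P.T ^ 2 ≤ x ^ 2 + y ^ 2) : P.coeffd x y < 0 ∨ P.coeffc x y < 0 := by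
  have htr := jac_trace_pos hP hp hcore
  rcases lt_or_ge 0 (P.n ^ 2 + P.coeffE x y) with h | h
  · right
    rw [coeffc, neg_mul, neg_lt_zero]
    exact mul_pos (coeffa_pos hP hW hp.1) h
  · left
    rw [coeffd_eq hp]
    -- The tangential direction is the negative one: the form there is `r₁² (3(n² + e) - tr)` with
    -- `n² + e ≤ 0 < tr`.
    refine det_neg_of_trace_pos_of_form_neg (s := -y) (t := x + P.mu) htr ?_
    rw [neg_sq, jac_form hp]
    exact mul_neg_of_pos_of_neg (pow_pos (lt_of_le_of_ne (Real.sqrt_nonneg _) (Ne.symm hp.1)) 2)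
      (by linarith)

theorem charDet_eq_quartic (hp : ![x, y, 0, 0] ∈ P.phaseSpace) :
    P.charDet x y = X ^ 4 + C (P.coeffa x y) * X ^ 3 + C (P.coeffb x y) * X ^ 2
      + C (P.coeffc x y) * X + C (P.coeffd x y) := by
  rw [charDet_eq hp, det_gyroscopic, coeffa_eq hp, coeffb_eq hp, coeffc_eq hp, coeffd_eq hp]

end Chermnykh
end

theorem mainTheorem1 (P : Chermnykh) (hP : P.Admissible) (hW : P.W1 ≠ 0)
    (x y : ℝ) (heq : P.IsEquilibrium x y)
    (hcore : P.Mb ≠ 0 → 2 * P.T ^ 2 ≤ x ^ 2 + y ^ 2) :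
    DifferentiableAt ℝ P.field ![x, y, 0, 0] ∧
    P.charDet x y =
      Polynomial.X ^ 4 + Polynomial.C (P.coeffa x y) * Polynomial.X ^ 3
        + Polynomial.C (P.coeffb x y) * Polynomial.X ^ 2
        + Polynomial.C (P.coeffc x y) * Polynomial.X + Polynomial.C (P.coeffd x y) ∧
    0 < P.coeffa x y ∧
    (∃ l : ℂ, Polynomial.aeval l (P.charDet x y) = 0 ∧ 0 < l.re) ∧
    ¬ LyapunovStable P.field P.phaseSpace ![x, y, 0, 0] := by
  obtain ⟨hp, hX, hY⟩ := heq
  have hF := Chermnykh.contDiffAt_field hp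
  have hd := hF.differentiableAt one_ne_zero
  have hroot : ∃ l : ℂ, Polynomial.aeval l (P.charDet x y) = 0 ∧ 0 < l.re := by
    rw [Chermnykh.charDet_eq_quartic hp]
    exact exists_root_re_pos_of_quartic (Chermnykh.coeffd_neg_or_coeffc_neg hP hW hp hcore)
  refine ⟨hd, Chermnykh.charDet_eq_quartic hp, Chermnykh.coeffa_pos hP hW hp.1, hroot, ?_⟩
  obtain ⟨l, hl, hre⟩ := hroot
  rw [Chermnykh.charDet_eq hp] at hl
  obtain ⟨u, v, hu, hv, huv⟩ := exists_eigenvector_of_gyroscopic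
    (Chermnykh.fderiv_field_apply hp) hl
  have hzero : P.field ![x, y, 0, 0] = 0 := by
    rw [Chermnykh.field, hX, hY]
    ext i
    fin_cases i <;> simp
  exact not_lyapunovStable_of_eigenvalue (Chermnykh.phaseSpace_mem_nhds hp) hF hzero
    hd.hasFDerivAt hre hu hv huv
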